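/- Let $T$ be a simplicial tree whose vertex set $V$ is countable and which is not isomorphic to the bi-infinite line, with graph metric $d$, let $k\ge 1$ be an integer, and let $G\le \mathrm{Aut}(T)$ be a subgroup. For a set $Y$ of vertices write $\mathrm{Fix}_G(Y)$ for the subgroup of all $g\in G$ that fix every vertex of $Y$. A reduced path is a sequence of adjacent vertices without backtracking; it is identified with its set of vertices $C$, and it may be finite, one-sided infinite or bi-infinite. For such $C$, and likewise for the pair of endpoints $C=\{x,y\}$ of an edge $e$ (where we write $e^{n}$ for $C^{n}$), let $C^{n}$ be the set of vertices at distance at most $n$ from $C$. For a vertex $x$ of $C$, let $T_x=\{z\in V : d(x,z)\le d(y,z)\text{ for all } y\in C\}$ be the fibre over $x$ of the nearest point projection to $C$. The group $\mathrm{Fix}_G(C^{k-1})$ preserves each $T_x$; let $F_x$ be the permutation group of $T_x$ that it induces. The group $G$ satisfies Property $P_k$ if for every reduced path $C$ the homomorphism $$\Phi:\mathrm{Fix}_G(C^{k-1})\to\prod_{x\in C}F_x$$ given by restriction is an isomorphism. The group $G$ is geometrically dense if it fixes no end of $T$ (an end is a class of geodesic rays, two rays being equivalent if they eventually coincide up to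 a shift of the parameter) and there is no proper (nonempty) subtree $Y\subsetneq T$ with $gY=Y$ for all $g\in G$. Suppose that $G$ is geometrically dense and satisfies Property $P_k$. Then the subgroup $$G^{+_k}=\langle \mathrm{Fix}_G(e^{k-1}) : e \text{ an edge of } T\rangle$$ is either trivial or simple as an abstract group. -/

import Mathlib

namespace TreeAut

variable {V : Type*} {T : SimpleGraph V}

/-- Graph automorphisms preserve the graph distance. -/
theorem dist_map (g : T ≃g T) (x y : V) : T.dist (g x) (g y) = T.dist x y := by
  have key : ∀ (h : T ≃g T) (a b : V), T.Reachable a b → T.dist (h a) (h b) ≤ T.dist a b := by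
    intro h a b hab
    obtain ⟨w, hw⟩ := hab.exists_walk_length_eq_dist
    have := SimpleGraph.dist_le (w.map h.toHom)
    rw [SimpleGraph.Walk.length_map, hw] at this
    exact this
  by_cases hxy : T.Reachable x y
  · apply le_antisymm (key g x y hxy)
    have h1 : T.Reachable (g x) (g y) := hxy.map g.toHom
    have h2 := key g.symm (g x) (g y) h1
    simpa using h2
  · have h1 : ¬ T.Reachable (g x) (g y) := fun h => hxy (by
      have h2 := h.map g.symm.toHom
      have e : ∀ v, g.symm.toHom (g v) = v := fun v => g.symm_apply_apply v
      rwa [e, e] at h2)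
    rw [SimpleGraph.dist_eq_zero_of_not_reachable hxy,
      SimpleGraph.dist_eq_zero_of_not_reachable h1]

/-! ### Ends -/

/-- A geodesic ray, recorded by its sequence of vertices. -/
structure Ray (T : SimpleGraph V) where
  toFun : ℕ → V
  isometric : ∀ i n : ℕ, T.dist (toFun i) (toFun (i + n)) = n

/-- Two rays are equivalent if they eventually coincide, up to a shift of the parameter. -/
def raySetoid (T : SimpleGraph V) : Setoid (Ray T) where
  r a b := ∃ m n : ℕ, ∀ i : ℕ, a.toFun (m + i) = b.toFun (n + i)
  iseqv :=
    { refl := fun _ => ⟨0, 0, fun _ => rfl⟩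
      symm := fun ⟨m, n, h⟩ => ⟨n, m, fun i => (h i).symm⟩
      trans := by
        rintro a b c ⟨m, n, h⟩ ⟨p, q, h'⟩
        refine ⟨m + p, q + n, fun i => ?_⟩
        rw [add_assoc, h, add_assoc q, ← h']
        congr 1
        omega }

/-- The boundary of the tree: the set of ends. -/
def Boundary (T : SimpleGraph V) : Type _ := Quotient (raySetoid T)

/-- The image of a ray under an automorphism. -/
def Ray.map (g : T ≃g T) (a : Ray T) : Ray T where
  toFun i := g (a.toFun i)
  isometric i n := by rw [dist_map, a.isometric]

/-- The action of an automorphism on the boundary. -/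
def Boundary.map (g : T ≃g T) : Boundary T → Boundary T :=
  Quotient.map (sa := raySetoid T) (sb := raySetoid T) (Ray.map g)
    (fun _ _ ⟨m, n, h⟩ => ⟨m, n, fun i => congrArg g (h i)⟩)

/-! ### Geometric density -/

/-- `G` fixes no end, and stabilizes no proper subtree. A subtree is given by its vertex set, a
set of vertices whose induced subgraph is connected (in particular nonempty). -/
def GeometricallyDense (G : Subgroup (T ≃g T)) : Prop :=
  (¬ ∃ ξ : Boundary T, ∀ g ∈ G, Boundary.map g ξ = ξ) ∧
  (¬ ∃ Y : Set V, (T.induce Y).Connected ∧ Y ≠ Set.univ ∧ ∀ g ∈ G, g '' Y = Y)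

/-! ### Fixators, neighbourhoods, projections -/

/-- The pointwise stabilizer in `G` of a set of vertices `Y`. -/
def fixator (G : Subgroup (T ≃g T)) (Y : Set V) : Subgroup (T ≃g T) where
  carrier := {g | g ∈ G ∧ ∀ y ∈ Y, g y = y}
  one_mem' := ⟨G.one_mem, fun _ _ => rfl⟩
  mul_mem' := by
    rintro a b ⟨ha, ha'⟩ ⟨hb, hb'⟩
    refine ⟨G.mul_mem ha hb, fun y hy => ?_⟩
    rw [RelIso.mul_apply, hb' y hy, ha' y hy]
  inv_mem' := by
    rintro a ⟨ha, ha'⟩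
    refine ⟨G.inv_mem ha, fun y hy => ?_⟩
    conv_lhs => rw [← ha' y hy]
    exact a.symm_apply_apply y

/-- The vertices at distance at most `n` from the set `C`. -/
def nbhd (T : SimpleGraph V) (C : Set V) (n : ℕ) : Set V :=
  {v | ∃ c ∈ C, T.dist c v ≤ n}

/-- The vertex set of the fibre over `x ∈ C` of the nearest point projection onto `C`. -/
def fibre (T : SimpleGraph V) (C : Set V) (x : V) : Set V :=
  {z | ∀ y ∈ C, T.dist x z ≤ T.dist y z}

/-- `C` is the vertex set of a reduced path (a sequence of adjacent vertices without backtracking),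
indexed by a nonempty interval of integers: the path may be finite, one-sided infinite or
bi-infinite. -/
def IsReducedPath (T : SimpleGraph V) (C : Set V) : Prop :=
  ∃ (I : Set ℤ) (c : ℤ → V), I.Nonempty ∧ I.OrdConnected ∧
    (∀ i, i ∈ I → i + 1 ∈ I → T.Adj (c i) (c (i + 1))) ∧
    (∀ i, i ∈ I → i + 2 ∈ I → c i ≠ c (i + 2)) ∧
    C = c '' I

/-! ### Independence -/

theorem fixator_mem_fibre_iff {G : Subgroup (T ≃g T)} {C : Set V} {n : ℕ}
    (g : fixator G (nbhd T C n)) {x : V} (hx : x ∈ C) (z : V) :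
    (g : T ≃g T) z ∈ fibre T C x ↔ z ∈ fibre T C x := by
  have hfix : ∀ y ∈ C, (g : T ≃g T) y = y := fun y hy =>
    g.2.2 y ⟨y, hy, by simp⟩
  have hd : ∀ y ∈ C, T.dist y ((g : T ≃g T) z) = T.dist y z := fun y hy => by
    conv_lhs => rw [← hfix y hy]
    exact dist_map _ _ _
  constructor
  · intro h y hy
    rw [← hd x hx, ← hd y hy]
    exact h y hy
  · intro h y hy
    rw [hd x hx, hd y hy]
    exact h y hy

/-- The pointwise stabilizer of the `n`-neighbourhood of `C` acts on the fibre over `x ∈ C`. -/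
def restrictHom (G : Subgroup (T ≃g T)) (C : Set V) (n : ℕ) (x : C) :
    fixator G (nbhd T C n) →* Equiv.Perm (fibre T C (x : V)) where
  toFun g := Equiv.Perm.subtypePerm (g : T ≃g T).toEquiv (fixator_mem_fibre_iff g x.2)
  map_one' := rfl
  map_mul' _ _ := rfl

/-- The homomorphism from the pointwise stabilizer of the `n`-neighbourhood of `C` to the product,
over the vertices `x` of `C`, of the permutation groups that it induces on the fibres. -/
def Phi (G : Subgroup (T ≃g T)) (C : Set V) (n : ℕ) :
    fixator G (nbhd T C n) →* ((x : C) → (restrictHom G C n x).range) :=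
  MonoidHom.pi fun x => (restrictHom G C n x).rangeRestrict

/-- Property `P_k`, for `k ≥ 1`. -/
def PropertyP (k : ℕ) (G : Subgroup (T ≃g T)) : Prop :=
  ∀ C : Set V, IsReducedPath T C → Function.Bijective (Phi G C (k - 1))

/-- The subgroup generated by the pointwise stabilizers in `G` of the `(k - 1)`-neighbourhoods of
the edges, for `k ≥ 1`. -/
def plus (k : ℕ) (G : Subgroup (T ≃g T)) : Subgroup (T ≃g T) :=
  ⨆ (x : V) (y : V) (_ : T.Adj x y), fixator G (nbhd T {x, y} (k - 1))

end TreeAut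

/-!
The proof is Tits's argument, carried out with half-trees. Write `half T x y` for the side of `y` of
an edge from `x` to `y`, and say that a group flips half-trees if for every half-tree `H` some
element maps the complement of `H` into `H`.

A geometrically dense group flips half-trees (`GeometricallyDense.flips`): if `H` is not flipped, the
translates of its complement meet pairwise, and they determine either a proper invariant subtree or
an invariant end. If `plus k G` is nontrivial, the tree has a vertex with three neighbours
(`branching_of_plus_ne_bot`); this already excludes the line. A commutator argument
(`Flips.exists_translation`) then shows that every nontrivial subgroup normalized by a group that
flips half-trees contains, in each half-tree, a translation: an element `u` mapping the complement
of a half-tree `B` into a half-tree disjoint from `B`. Such a subgroup therefore flips half-trees in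
turn. This is applied to `plus k G` in `G`, and then to a normal subgroup `N` of `plus k G`.

A translation has an axis `C` (`exists_axis`). By Property `P_k` every element of the fixator of
`C^{k-1}` is a commutator of the translation with an element of this fixator
(`PropertyP.exists_commutator`), so it lies in `N`. By Property `P_k` for an edge `e`, the fixator of
`e^{k-1}` is generated by its elements that fix one of the two half-trees of `e` pointwise
(`PropertyP.fixator_edge_le`). Such an element fixes `C^{k-1}` for every axis `C` in this half-tree,
so it lies in `N`. Hence `N` contains all generators of `plus k G`.
-/

namespace TreeAut

variable {V : Type*} {T : SimpleGraph V}

/-! ### Distances and half-trees -/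

theorem exists_adj_closer (hT : T.IsTree) {u v : V} (h : u ≠ v) :
    ∃ w, T.Adj v w ∧ T.dist u v = T.dist u w + 1 := by
  obtain ⟨p, hp⟩ := hT.connected.exists_walk_length_eq_dist v u
  cases p with
  | nil => exact absurd rfl h
  | @cons _ w _ hadj q =>
    refine ⟨w, hadj, ?_⟩
    have h1 := SimpleGraph.dist_le q
    rw [SimpleGraph.Walk.length_cons] at hp
    have h2 := hT.dist_eq_dist_add_one_of_adj u hadj
    rw [T.dist_comm] at h1 hp
    omega

/-- In a tree rooted at `u`, every vertex has at most one parent. -/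
theorem closer_unique (hT : T.IsTree) {u v w w' : V} (h : T.Adj v w) (h' : T.Adj v w')
    (hd : T.dist u v = T.dist u w + 1) (hd' : T.dist u v = T.dist u w' + 1) : w = w' := by
  obtain ⟨p, hp⟩ := hT.connected.exists_walk_length_eq_dist u w
  obtain ⟨p', hp'⟩ := hT.connected.exists_walk_length_eq_dist u w'
  have h1 : (p.concat h.symm).IsPath := SimpleGraph.Walk.isPath_of_length_eq_dist _ (by
    rw [SimpleGraph.Walk.length_concat]; omega)
  have h2 : (p'.concat h'.symm).IsPath := SimpleGraph.Walk.isPath_of_length_eq_dist _ (by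
    rw [SimpleGraph.Walk.length_concat]; omega)
  have e := (hT.isAcyclic.subsingleton_path u v).elim ⟨_, h1⟩ ⟨_, h2⟩
  have e' := congrArg (fun q : T.Path u v => (q : T.Walk u v).penultimate) e
  simpa using e'

/-- The half-tree of the vertices on the side of `y` of the edge from `x` to `y`. -/
def half (T : SimpleGraph V) (x y : V) : Set V := {z | T.dist z y < T.dist z x}

theorem right_mem_half {x y : V} (h : T.Adj x y) : y ∈ half T x y := by
  have : T.dist y x = 1 := SimpleGraph.dist_eq_one_iff_adj.2 h.symm
  simp [half, this]

theorem left_notMem_half {x y : V} : x ∉ half T x y := by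
  simp [half]

theorem notMem_half_iff (hT : T.IsTree) {x y z : V} (h : T.Adj x y) :
    z ∉ half T x y ↔ z ∈ half T y x := by
  have := hT.dist_ne_of_adj z h
  simp only [half, Set.mem_ofPred_eq]
  omega

theorem dist_of_mem_half (hT : T.IsTree) {x y z : V} (h : T.Adj x y) (hz : z ∈ half T x y) :
    T.dist z x = T.dist z y + 1 := by
  have := hT.dist_eq_dist_add_one_of_adj z h
  simp only [half, Set.mem_ofPred_eq] at hz
  omega

theorem map_mem_half (g : T ≃g T) {x y z : V} :
    g z ∈ half T (g x) (g y) ↔ z ∈ half T x y := by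
  simp [half, dist_map]

theorem mem_half_map (g : T ≃g T) {x y z : V} :
    z ∈ half T (g x) (g y) ↔ g⁻¹ z ∈ half T x y := by
  rw [← map_mem_half g (z := g⁻¹ z), RelIso.apply_inv_self]

/-- The only edge leaving a half-tree is the one that defines it. -/
theorem eq_of_adj_of_mem_half (hT : T.IsTree) {x y a b : V} (h : T.Adj x y) (hab : T.Adj a b)
    (ha : a ∈ half T x y) (hb : b ∉ half T x y) : a = y ∧ b = x := by
  have hb' := (notMem_half_iff hT h).1 hb
  have h1 := dist_of_mem_half hT h ha
  have h2 := dist_of_mem_half hT h.symm hb'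
  have h3 := hT.dist_eq_dist_add_one_of_adj x hab
  have h4 := hT.dist_eq_dist_add_one_of_adj y hab
  simp only [T.dist_comm (u := x), T.dist_comm (u := y)] at h3 h4
  have hay : y = a := by
    by_contra hne
    obtain ⟨c, hac, hc⟩ := exists_adj_closer hT hne
    have h5 := hT.dist_eq_dist_add_one_of_adj c h
    have h6 := hT.dist_eq_dist_add_one_of_adj x hac
    simp only [T.dist_comm (u := x), T.dist_comm (u := y)] at hc h6
    have : c = b := closer_unique hT (u := x) hac hab
      (by simp only [T.dist_comm (u := x)]; omega) (by simp only [T.dist_comm (u := x)]; omega)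
    subst this
    omega
  subst hay
  refine ⟨rfl, ?_⟩
  have : T.dist b x = 0 := by simp only [T.dist_self] at h1 h2 h4; omega
  exact hT.connected.dist_eq_zero_iff.1 this

/-- Half-trees are convex: a neighbour of `u` one step closer to `v` lies in every half-tree that
contains `u` and `v`. -/
theorem half_convex_step (hT : T.IsTree) {x y u v w : V} (h : T.Adj x y) (hu : u ∈ half T x y)
    (hv : v ∈ half T x y) (huw : T.Adj u w) (hd : T.dist v u = T.dist v w + 1) :
    w ∈ half T x y := by
  by_contra hw
  obtain ⟨rfl, rfl⟩ := eq_of_adj_of_mem_half hT h huw hu hw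
  simp only [half, Set.mem_ofPred_eq] at hv
  omega

/-- A half-tree is connected, so a set that none of its edges crosses contains all or none of
it. -/
theorem mem_iff_of_mem_half (hT : T.IsTree) {x y : V} (h : T.Adj x y) (S : Set V)
    (hS : ∀ a b, T.Adj a b → a ∈ half T x y → b ∈ half T x y → (a ∈ S ↔ b ∈ S)) :
    ∀ {a}, a ∈ half T x y → (a ∈ S ↔ y ∈ S) := by
  suffices ∀ n a, T.dist y a = n → a ∈ half T x y → (a ∈ S ↔ y ∈ S) from
    fun {a} => this _ a rfl
  intro n
  induction n with
  | zero =>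
    intro a ha _
    rw [hT.connected.dist_eq_zero_iff.1 ha]
  | succ n ih =>
    intro a ha hmem
    have hne : y ≠ a := by rintro rfl; simp at ha
    obtain ⟨b, hab, hb⟩ := exists_adj_closer hT hne
    have hbm := half_convex_step hT h hmem (right_mem_half h) hab hb
    rw [hS a b hab hmem hbm]
    exact ih b (by omega) hbm

theorem half_subset_or_disjoint (hT : T.IsTree) {x y x' y' : V} (h : T.Adj x y)
    (h' : T.Adj x' y') (hn : ¬ (x' ∈ half T x y ∧ y' ∈ half T x y)) :
    half T x y ⊆ half T x' y' ∨ Disjoint (half T x y) (half T x' y') := by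
  have key : ∀ {a}, a ∈ half T x y → (a ∈ half T x' y' ↔ y ∈ half T x' y') := by
    refine mem_iff_of_mem_half hT h _ fun a b hab ha hb => ?_
    by_contra hc
    by_cases ha' : a ∈ half T x' y'
    · have hb' : b ∉ half T x' y' := fun hb' => hc (by simp [ha', hb'])
      obtain ⟨rfl, rfl⟩ := eq_of_adj_of_mem_half hT h' hab ha' hb'
      exact hn ⟨hb, ha⟩
    · have hb' : b ∈ half T x' y' := by
        by_contra hb'
        exact hc (by simp [ha', hb'])
      obtain ⟨rfl, rfl⟩ := eq_of_adj_of_mem_half hT h' hab.symm hb' ha'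
      exact hn ⟨ha, hb⟩
  by_cases hy : y ∈ half T x' y'
  · exact Or.inl fun a ha => (key ha).2 hy
  · exact Or.inr (Set.disjoint_left.2 fun a ha ha' => hy ((key ha).1 ha'))

/-- Two half-trees are nested, disjoint, or cover the tree. -/
theorem half_nested (hT : T.IsTree) {x y x' y' : V} (h : T.Adj x y) (h' : T.Adj x' y') :
    half T x y ⊆ half T x' y' ∨ Disjoint (half T x y) (half T x' y') ∨
      half T x' y' ⊆ half T x y ∨ ∀ z, z ∉ half T x y → z ∈ half T x' y' := by
  by_cases hn : x' ∈ half T x y ∧ y' ∈ half T x y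
  · have := half_subset_or_disjoint hT h.symm h' (fun hc =>
      (notMem_half_iff hT h).2 hc.1 hn.1)
    rcases this with h1 | h1
    · exact Or.inr (Or.inr (Or.inr fun z hz => h1 ((notMem_half_iff hT h).1 hz)))
    · refine Or.inr (Or.inr (Or.inl fun z hz => ?_))
      by_contra hc
      exact Set.disjoint_left.1 h1 ((notMem_half_iff hT h).1 hc) hz
  · rcases half_subset_or_disjoint hT h h' hn with h1 | h1
    · exact Or.inl h1
    · exact Or.inr (Or.inl h1)

/-- Half-trees whose base vertices lie outside both are disjoint, unless they have the same base
vertex. -/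
theorem disjoint_half_of_notMem (hT : T.IsTree) {x y x' y' : V} (h : T.Adj x y)
    (h' : T.Adj x' y') (hx : x ∉ half T x' y') (hx' : x' ∉ half T x y) (hne : x ≠ x') :
    Disjoint (half T x y) (half T x' y') := by
  rcases half_subset_or_disjoint hT h h' (fun hc => hx' hc.1) with h1 | h1
  · exact absurd (eq_of_adj_of_mem_half hT h' h.symm (h1 (right_mem_half h)) hx).2 hne
  · exact h1

/-- The branches at a vertex are pairwise disjoint. -/
theorem disjoint_branches (hT : T.IsTree) {x y y' : V} (h : T.Adj x y) (h' : T.Adj x y')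
    (hne : y ≠ y') : Disjoint (half T x y) (half T x y') := by
  refine Set.disjoint_left.2 fun z hz hz' => hne ?_
  exact closer_unique hT (u := z) h h' (dist_of_mem_half hT h hz) (dist_of_mem_half hT h' hz')

/-- A half-tree that misses `v` lies in one branch at `v`. -/
theorem exists_half_subset_branch (hT : T.IsTree) {x y v : V} (h : T.Adj x y)
    (hv : v ∉ half T x y) : ∃ w, T.Adj v w ∧ half T x y ⊆ half T v w := by
  have hne : y ≠ v := fun e => hv (e ▸ right_mem_half h)
  obtain ⟨w, hvw, hw⟩ := exists_adj_closer hT hne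
  refine ⟨w, hvw, ?_⟩
  rcases half_subset_or_disjoint hT h hvw (fun hc => hv hc.1) with h1 | h1
  · exact h1
  · refine absurd ?_ (Set.disjoint_left.1 h1 (right_mem_half h))
    simp only [half, Set.mem_ofPred_eq]
    omega

/-- A sequence of adjacent vertices without backtracking is geodesic. -/
theorem dist_of_noBacktrack (hT : T.IsTree) (p : ℕ → V) (N : ℕ)
    (hadj : ∀ i < N, T.Adj (p i) (p (i + 1))) (hb : ∀ i, i + 1 < N → p i ≠ p (i + 2)) :
    ∀ n ≤ N, T.dist (p 0) (p n) = n := by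
  intro n
  induction n using Nat.strong_induction_on with
  | _ n ih =>
    intro hn
    match n with
    | 0 => simp
    | 1 => exact SimpleGraph.dist_eq_one_iff_adj.2 (hadj 0 (by omega))
    | n + 2 =>
      have h1 := ih (n + 1) (by omega) (by omega)
      have h0 := ih n (by omega) (by omega)
      have a1 := hadj (n + 1) (by omega)
      rcases hT.dist_eq_dist_add_one_of_adj (p 0) a1 with h2 | h2
      · exact absurd (closer_unique hT (u := p 0) (hadj n (by omega)).symm a1 (by omega) h2)
          (hb n (by omega))
      · rw [show n + 2 = n + 1 + 1 from rfl, h2, h1]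

/-- Two vertices are joined by a geodesic. -/
theorem exists_geodesic (hT : T.IsTree) (u v : V) :
    ∃ p : ℕ → V, p 0 = u ∧ p (T.dist u v) = v ∧ (∀ i < T.dist u v, T.Adj (p i) (p (i + 1))) ∧
      (∀ i ≤ T.dist u v, T.dist u (p i) = i ∧ T.dist v (p i) = T.dist u v - i) := by
  obtain ⟨q, hq⟩ := hT.connected.exists_walk_length_eq_dist u v
  refine ⟨q.getVert, q.getVert_zero, by rw [← hq]; exact q.getVert_length,
    fun i hi => q.adj_getVert_succ (by omega), fun i hi => ?_⟩
  have h1 := SimpleGraph.dist_le (q.take i)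
  have h2 := SimpleGraph.dist_le (q.drop i)
  have h3 := hT.connected.dist_triangle (u := u) (v := q.getVert i) (w := v)
  rw [SimpleGraph.Walk.take_length] at h1
  rw [SimpleGraph.Walk.drop_length] at h2
  rw [T.dist_comm (u := v)]
  omega

/-- A vertex on a geodesic is determined by its distances to the two endpoints. -/
theorem eq_of_dist_eq (hT : T.IsTree) {a b v v' : V}
    (h : T.dist a v + T.dist v b = T.dist a b) (h1 : T.dist a v' = T.dist a v)
    (h2 : T.dist v' b = T.dist v b) : v = v' := by
  obtain ⟨q, hq⟩ := hT.connected.exists_walk_length_eq_dist a v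
  obtain ⟨r, hr⟩ := hT.connected.exists_walk_length_eq_dist v b
  obtain ⟨q', hq'⟩ := hT.connected.exists_walk_length_eq_dist a v'
  obtain ⟨r', hr'⟩ := hT.connected.exists_walk_length_eq_dist v' b
  have p1 : (q.append r).IsPath := SimpleGraph.Walk.isPath_of_length_eq_dist _ (by
    rw [SimpleGraph.Walk.length_append]; omega)
  have p2 : (q'.append r').IsPath := SimpleGraph.Walk.isPath_of_length_eq_dist _ (by
    rw [SimpleGraph.Walk.length_append]; omega)
  have e := congrArg (fun s : T.Path a b => (s : T.Walk a b).getVert (T.dist a v))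
    ((hT.isAcyclic.subsingleton_path a b).elim ⟨_, p1⟩ ⟨_, p2⟩)
  have e1 : (q.append r).getVert (T.dist a v) = v := by
    rw [← hq, SimpleGraph.Walk.getVert_append]; simp
  have e2 : (q'.append r').getVert (T.dist a v) = v' := by
    rw [← h1, ← hq', SimpleGraph.Walk.getVert_append]; simp
  simp only [e1, e2] at e
  exact e

theorem dist_of_mem_half_of_notMem (hT : T.IsTree) {x y : V} (h : T.Adj x y) {u w : V}
    (hu : u ∈ half T x y) (hw : w ∉ half T x y) :
    T.dist u w = T.dist u y + 1 + T.dist x w := by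
  suffices ∀ n u, T.dist w u = n → u ∈ half T x y → T.dist u y + 1 + T.dist x w ≤ T.dist u w by
    refine le_antisymm ?_ (this _ u rfl hu)
    have h1 := hT.connected.dist_triangle (u := u) (v := y) (w := w)
    have h2 := hT.connected.dist_triangle (u := y) (v := x) (w := w)
    rw [SimpleGraph.dist_eq_one_iff_adj.2 h.symm] at h2
    omega
  intro n
  induction n using Nat.strong_induction_on with
  | _ n ih =>
    intro u hn hu
    have hne : w ≠ u := fun e => hw (e ▸ hu)
    obtain ⟨b, hub, hb⟩ := exists_adj_closer hT hne
    by_cases hbm : b ∈ half T x y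
    · have h1 := ih _ (by omega) b rfl hbm
      have h2 := hT.connected.dist_triangle (u := u) (v := b) (w := y)
      rw [SimpleGraph.dist_eq_one_iff_adj.2 hub] at h2
      rw [T.dist_comm (u := w), T.dist_comm (u := w)] at hb
      omega
    · obtain ⟨rfl, rfl⟩ := eq_of_adj_of_mem_half hT h hub hu hbm
      rw [T.dist_comm (u := w), T.dist_comm (u := w)] at hb
      simp [hb]; omega

/-- Half-trees are convex. -/
theorem half_convex (hT : T.IsTree) {x y : V} (h : T.Adj x y) {u v w : V}
    (hu : u ∈ half T x y) (hv : v ∈ half T x y) (hw : T.dist u w + T.dist v w = T.dist u v) :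
    w ∈ half T x y := by
  by_contra hc
  have h1 := dist_of_mem_half_of_notMem hT h hu hc
  have h2 := dist_of_mem_half_of_notMem hT h hv hc
  have h3 := hT.connected.dist_triangle (u := u) (v := y) (w := v)
  rw [T.dist_comm (u := y)] at h3
  omega

/-! ### Flipping half-trees -/

/-- Every half-tree is flipped by `M`: some element of `M` maps its complement into it. -/
def Flips (M : Subgroup (T ≃g T)) : Prop :=
  ∀ x y, T.Adj x y → ∃ m ∈ M, ∀ z, z ∉ half T x y → m z ∈ half T x y

/-- An equivariant choice of a direction at each vertex, no two of which point away from each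
other along an edge, defines an invariant end. -/
theorem exists_fixed_end (hT : T.IsTree) (G : Subgroup (T ≃g T)) (f : V → V)
    (hadj : ∀ v, T.Adj v (f v)) (hback : ∀ v, f (f v) ≠ v)
    (hedge : ∀ v w, T.Adj v w → f v = w ∨ f w = v) (hequi : ∀ g ∈ G, ∀ v, f (g v) = g (f v)) :
    ∃ ξ : Boundary T, ∀ g ∈ G, Boundary.map g ξ = ξ := by
  let r : V → Ray T := fun v =>
    { toFun := fun i => f^[i] v
      isometric := fun i n => dist_of_noBacktrack hT (fun j => f^[i + j] v) n
        (fun j _ => by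
          change T.Adj (f^[i + j] v) (f^[(i + j) + 1] v)
          rw [Function.iterate_succ_apply']; exact hadj _)
        (fun j _ => by
          change f^[i + j] v ≠ f^[(i + j) + 1 + 1] v
          rw [Function.iterate_succ_apply', Function.iterate_succ_apply']
          exact (hback _).symm) n le_rfl }
  have hr : ∀ v w, (raySetoid T).r (r v) (r w) := by
    intro v w
    obtain ⟨p⟩ := hT.connected v w
    induction p with
    | nil => exact (raySetoid T).refl _
    | @cons a b c hab _ ih =>
      refine (raySetoid T).trans ?_ ih
      rcases hedge a b hab with e | e
      · exact ⟨1, 0, fun i => by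
          change f^[1 + i] a = f^[0 + i] b
          rw [add_comm 1, Function.iterate_succ_apply, e, zero_add]⟩
      · exact ⟨0, 1, fun i => by
          change f^[0 + i] a = f^[1 + i] b
          rw [add_comm 1, Function.iterate_succ_apply, e, zero_add]⟩
  obtain ⟨v⟩ := hT.connected.nonempty
  refine ⟨Quotient.mk (raySetoid T) (r v), fun g hg => ?_⟩
  refine Quotient.sound (s := raySetoid T) ?_
  have e : Ray.map g (r v) = r (g v) := by
    have : ∀ i, g (f^[i] v) = f^[i] (g v) := by
      intro i
      induction i with
      | zero => rfl
      | succ i ih => rw [Function.iterate_succ_apply', Function.iterate_succ_apply', ← ih, hequi g hg]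
    simp only [Ray.map, r, this]
  rw [e]
  exact hr _ _

/-- If some half-tree is not flipped, then the translates of its complement `K` meet pairwise.
If they have a common vertex, their intersection is a proper invariant subtree; otherwise each
vertex points towards the translates of `K` that miss it, which defines an invariant end. -/
theorem GeometricallyDense.flips (hT : T.IsTree) {G : Subgroup (T ≃g T)}
    (hG : GeometricallyDense G) : Flips G := by
  by_contra hc
  simp only [Flips, not_forall] at hc
  obtain ⟨x, y, h, hno⟩ := hc
  push Not at hno
  have hmeet : ∀ g ∈ G, ∀ g' ∈ G, ¬ Disjoint (half T (g y) (g x)) (half T (g' y) (g' x)) := by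
    intro g hg g' hg' hd
    obtain ⟨z, hz, hz'⟩ := hno (g'⁻¹ * g) (G.mul_mem (G.inv_mem hg') hg)
    rw [notMem_half_iff hT h] at hz hz'
    rw [RelIso.mul_apply, ← mem_half_map] at hz'
    exact Set.disjoint_left.1 hd ((map_mem_half g).2 hz) hz'
  by_cases hY : ∃ v, ∀ g ∈ G, v ∈ half T (g y) (g x)
  · refine hG.2 ⟨{v | ∀ g ∈ G, v ∈ half T (g y) (g x)}, ?_, ?_, ?_⟩
    · rw [SimpleGraph.connected_iff]
      refine ⟨?_, ⟨_, hY.choose_spec⟩⟩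
      rintro ⟨u, hu⟩ ⟨v, hv⟩
      obtain ⟨n, hn⟩ : ∃ n, T.dist v u = n := ⟨_, rfl⟩
      induction n generalizing u with
      | zero =>
        obtain rfl := hT.connected.dist_eq_zero_iff.1 hn
        rfl
      | succ n ih =>
        have hne : v ≠ u := by rintro rfl; simp at hn
        obtain ⟨w, huw, hw⟩ := exists_adj_closer hT hne
        have hwY : ∀ g ∈ G, w ∈ half T (g y) (g x) := fun g hg =>
          half_convex_step hT (g.map_adj_iff.2 h.symm) (hu g hg) (hv g hg) huw hw
        have hadj : (T.induce {v | ∀ g ∈ G, v ∈ half T (g y) (g x)}).Adj ⟨u, hu⟩ ⟨w, hwY⟩ := huw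
        exact hadj.reachable.trans (ih w hwY (by omega))
    · intro e
      have : y ∈ {v | ∀ g ∈ G, v ∈ half T (g y) (g x)} := e ▸ Set.mem_univ y
      exact left_notMem_half (this 1 G.one_mem)
    · intro g hg
      have key : ∀ g ∈ G, ∀ v, (∀ g ∈ G, v ∈ half T (g y) (g x)) →
          ∀ g' ∈ G, g v ∈ half T (g' y) (g' x) := by
        intro g hg v hv g' hg'
        have := hv (g⁻¹ * g') (G.mul_mem (G.inv_mem hg) hg')
        rw [← map_mem_half g] at this
        simpa [RelIso.mul_apply, RelIso.apply_inv_self] using this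
      ext v
      constructor
      · rintro ⟨v, hv, rfl⟩
        exact key g hg v hv
      · intro hv
        exact ⟨g⁻¹ v, key g⁻¹ (G.inv_mem hg) v hv, RelIso.apply_inv_self _ _⟩
  · push Not at hY
    have hf : ∀ v, ∃ w, T.Adj v w ∧ ∃ g ∈ G, half T (g y) (g x) ⊆ half T v w := by
      intro v
      obtain ⟨g, hg, hv⟩ := hY v
      obtain ⟨w, hw, hs⟩ := exists_half_subset_branch hT (g.map_adj_iff.2 h.symm) hv
      exact ⟨w, hw, g, hg, hs⟩
    choose f hadj hfs using hf
    have huniq : ∀ v w, T.Adj v w → (∃ g ∈ G, half T (g y) (g x) ⊆ half T v w) → f v = w := by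
      rintro v w hvw ⟨g, hg, hs⟩
      obtain ⟨g', hg', hs'⟩ := hfs v
      by_contra hne
      exact hmeet g' hg' g hg ((disjoint_branches hT (hadj v) hvw hne).mono hs' hs)
    have hedge : ∀ v w, T.Adj v w → f v = w ∨ f w = v := by
      intro v w hvw
      by_cases e : f v = w
      · exact Or.inl e
      · refine Or.inr (huniq w v hvw.symm ?_)
        obtain ⟨g, hg, hs⟩ := hfs v
        refine ⟨g, hg, fun z hz => (notMem_half_iff hT hvw).1 ?_⟩
        exact Set.disjoint_left.1 (disjoint_branches hT (hadj v) hvw e) (hs hz)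
    refine hG.1 (exists_fixed_end hT G f hadj ?_ hedge ?_)
    · intro v hv
      obtain ⟨g, hg, hs⟩ := hfs v
      obtain ⟨g', hg', hs'⟩ := hfs (f v)
      rw [hv] at hs'
      refine hmeet g hg g' hg' (Set.disjoint_left.2 fun z hz hz' => ?_)
      exact (notMem_half_iff hT (hadj v).symm).2 (hs hz) (hs' hz')
    · intro g hg v
      obtain ⟨g', hg', hs⟩ := hfs v
      refine huniq _ _ (g.map_adj_iff.2 (hadj v)) ⟨g * g', G.mul_mem hg hg', fun z hz => ?_⟩
      rw [mem_half_map]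
      exact hs ((mem_half_map g).1 hz)

/-- Any half-tree complement can be moved into any half-tree. -/
theorem Flips.exists_map_compl (hT : T.IsTree) {M : Subgroup (T ≃g T)} (hM : Flips M)
    {x y x' y' : V} (h : T.Adj x y) (h' : T.Adj x' y') :
    ∃ m ∈ M, ∀ z, z ∉ half T x y → m z ∈ half T x' y' := by
  obtain ⟨f, hf, hf'⟩ := hM x y h
  obtain ⟨g, hg, hg'⟩ := hM x' y' h'
  rcases half_nested hT h h' with h1 | h1 | h1 | h1
  · exact ⟨f, hf, fun z hz => h1 (hf' z hz)⟩
  · exact ⟨g * f, M.mul_mem hg hf, fun z hz => hg' _ (Set.disjoint_left.1 h1 (hf' z hz))⟩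
  · exact ⟨g, hg, fun z hz => hg' _ fun hc => hz (h1 hc)⟩
  · exact ⟨1, M.one_mem, h1⟩

/-- Some vertex has at least three neighbours. -/
def Branching (T : SimpleGraph V) : Prop :=
  ∃ p a b c, T.Adj p a ∧ T.Adj p b ∧ T.Adj p c ∧ a ≠ b ∧ a ≠ c ∧ b ≠ c

/-- A nontrivial automorphism that fixes an edge moves a neighbour of some fixed vertex that also
has a fixed neighbour. -/
theorem branching_of_fix_edge (hT : T.IsTree) {g : T ≃g T} (hg : g ≠ 1) {x y : V}
    (h : T.Adj x y) (hx : g x = x) (hy : g y = y) : Branching T := by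
  classical
  have hex : ∃ n v, T.dist x v = n ∧ g v ≠ v := by
    by_contra hc
    push Not at hc
    exact hg (RelIso.ext fun v => hc _ v rfl)
  obtain ⟨v, hv, hgv⟩ := Nat.find_spec hex
  have hmin : ∀ w, T.dist x w < T.dist x v → g w = w := by
    intro w hw
    by_contra hc
    exact Nat.find_min hex (hv ▸ hw) ⟨w, rfl, hc⟩
  have hne : x ≠ v := by rintro rfl; exact hgv hx
  obtain ⟨p, hvp, hp⟩ := exists_adj_closer hT hne
  have hgp : g p = p := hmin p (by omega)
  have hthird : ∃ q, T.Adj p q ∧ g q = q := by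
    by_cases hpx : x = p
    · exact ⟨y, hpx ▸ h, hy⟩
    · obtain ⟨q, hpq, hq⟩ := exists_adj_closer hT hpx
      exact ⟨q, hpq, hmin q (by omega)⟩
  obtain ⟨q, hpq, hq⟩ := hthird
  have hpgv : T.Adj p (g v) := by
    have := g.map_adj_iff.2 hvp.symm
    rwa [hgp] at this
  refine ⟨p, q, v, g v, hpq, hvp.symm, hpgv, ?_, ?_, hgv.symm⟩
  · rintro rfl; exact hgv hq
  · intro e; exact hgv (g.injective (by rw [← e, hq, e]))

theorem Flips.exists_disjoint_halves (hT : T.IsTree) {M : Subgroup (T ≃g T)} (hM : Flips M)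
    (hbr : Branching T) {x y : V} (h : T.Adj x y) :
    ∃ a a' b b', T.Adj a a' ∧ T.Adj b b' ∧ half T a a' ⊆ half T x y ∧
      half T b b' ⊆ half T x y ∧ Disjoint (half T a a') (half T b b') := by
  obtain ⟨p, a, b, c, ha, hb, hc, hab, hac, hbc⟩ := hbr
  obtain ⟨s, -, hs⟩ := hM.exists_map_compl hT hc h
  have key : ∀ q, T.Adj p q → q ≠ c → half T (s p) (s q) ⊆ half T x y := by
    intro q hq hqc z hz
    rw [mem_half_map] at hz
    have := hs _ (Set.disjoint_left.1 (disjoint_branches hT hq hc hqc) hz)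
    rwa [RelIso.apply_inv_self] at this
  refine ⟨s p, s a, s p, s b, s.map_adj_iff.2 ha, s.map_adj_iff.2 hb, key a ha hac, key b hb hbc,
    disjoint_branches hT (s.map_adj_iff.2 ha) (s.map_adj_iff.2 hb) (s.injective.ne hab)⟩

/-- If `n` maps no half-tree off itself, it fixes each vertex `p` with three neighbours: if
`n p ≠ p`, then `n p` lies in at most one of three branches at `p`, and `p` in at most one of their
images, so the remaining branch is mapped off itself. -/
theorem apply_eq_of_tripod (hT : T.IsTree) {n : T ≃g T}
    (hn : ∀ x y, T.Adj x y → ∃ z ∈ half T x y, n z ∈ half T x y) {p a b c : V} (ha : T.Adj p a)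
    (hb : T.Adj p b) (hc : T.Adj p c) (hab : a ≠ b) (hac : a ≠ c) (hbc : b ≠ c) : n p = p := by
  by_contra hne
  have key : ∀ q, T.Adj p q → n p ∈ half T p q ∨ p ∈ half T (n p) (n q) := by
    intro q hq
    by_contra hcon
    push Not at hcon
    obtain ⟨z, hz, hnz⟩ := hn p q hq
    exact Set.disjoint_left.1 (disjoint_half_of_notMem hT hq (n.map_adj_iff.2 hq) hcon.2 hcon.1
      (Ne.symm hne)) hnz ((map_mem_half n).2 hz)
  have d1 : ∀ q q', T.Adj p q → T.Adj p q' → q ≠ q' →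
      ¬ (n p ∈ half T p q ∧ n p ∈ half T p q') := fun q q' h h' e hh =>
    Set.disjoint_left.1 (disjoint_branches hT h h' e) hh.1 hh.2
  have d2 : ∀ q q', T.Adj p q → T.Adj p q' → q ≠ q' →
      ¬ (p ∈ half T (n p) (n q) ∧ p ∈ half T (n p) (n q')) := fun q q' h h' e hh =>
    Set.disjoint_left.1 (disjoint_branches hT (n.map_adj_iff.2 h) (n.map_adj_iff.2 h')
      (n.injective.ne e)) hh.1 hh.2
  have := key a ha
  have := key b hb
  have := key c hc
  have := d1 a b ha hb hab
  have := d1 a c ha hc hac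
  have := d1 b c hb hc hbc
  have := d2 a b ha hb hab
  have := d2 a c ha hc hac
  have := d2 b c hb hc hbc
  tauto

/-- A nontrivial automorphism maps some half-tree off itself. Otherwise it fixes every vertex with
three neighbours; these occur in every half-tree, so every vertex lies between two fixed ones. -/
theorem Flips.exists_half_disjoint_image (hT : T.IsTree) {M : Subgroup (T ≃g T)} (hM : Flips M)
    (hbr : Branching T) {n : T ≃g T} (hn : n ≠ 1) :
    ∃ x y, T.Adj x y ∧ ∀ z ∈ half T x y, n z ∉ half T x y := by
  by_contra hcon
  push Not at hcon
  obtain ⟨p, a, b, c, ha, hb, hc, hab, hac, hbc⟩ := hbr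
  have hfix : ∀ s : T ≃g T, n (s p) = s p := fun s =>
    apply_eq_of_tripod hT hcon (s.map_adj_iff.2 ha) (s.map_adj_iff.2 hb) (s.map_adj_iff.2 hc)
      (s.injective.ne hab) (s.injective.ne hac) (s.injective.ne hbc)
  refine hn (RelIso.ext fun v => ?_)
  change n v = v
  by_cases hpv : p = v
  · subst hpv; exact hfix 1
  obtain ⟨w, hvw, hw⟩ := exists_adj_closer hT hpv
  obtain ⟨s, -, hs⟩ := hM.exists_map_compl hT hc hvw.symm
  have h1 := hs p left_notMem_half
  have h2 : p ∉ half T w v := by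
    simp only [half, Set.mem_ofPred_eq]; omega
  have h3 := dist_of_mem_half_of_notMem hT hvw.symm h1 h2
  have h0 : n p = p := hfix 1
  rw [T.dist_comm (u := w)] at h3
  refine (eq_of_dist_eq hT (a := s p) (b := p) (v := v) (v' := n v) ?_ ?_ ?_).symm
  · rw [T.dist_comm (u := v)]; omega
  · conv_lhs => rw [← hfix s]
    exact dist_map _ _ _
  · conv_lhs => rw [← h0]
    exact dist_map _ _ _

/-- A nontrivial subgroup normalized by a group that flips half-trees contains, in each half-tree,
a translation. With `n` mapping `half x₀ y₀` off itself, disjoint half-trees `A` and `B` of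
`half x₀ y₀`, and `m` mapping the complement of `A` into `B`, the commutator of `n` and `m` maps the
complement of `B` into `n B`; conjugation moves both into the given half-tree. -/
theorem Flips.exists_translation (hT : T.IsTree) {M N : Subgroup (T ≃g T)} (hM : Flips M)
    (hbr : Branching T) (hN : N ≠ ⊥) (hnorm : ∀ m ∈ M, ∀ n ∈ N, m * n * m⁻¹ ∈ N) {x y : V}
    (h : T.Adj x y) :
    ∃ u ∈ N, ∃ b b' d d', T.Adj b b' ∧ T.Adj d d' ∧ half T b b' ⊆ half T x y ∧
      half T d d' ⊆ half T x y ∧ Disjoint (half T b b') (half T d d') ∧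
      (∃ w, w ∉ half T b b' ∧ w ∉ half T d d') ∧
      ∀ z, z ∉ half T b b' → u z ∈ half T d d' := by
  obtain ⟨⟨n, hnN⟩, hn⟩ := Subgroup.ne_bot_iff_exists_ne_one.1 hN
  have hn1 : n ≠ 1 := fun e => hn (Subtype.ext e)
  obtain ⟨x₀, y₀, h₀, hoff⟩ := hM.exists_half_disjoint_image hT hbr hn1
  obtain ⟨a, a', b, b', ha, hb, hA, hB, hAB⟩ := hM.exists_disjoint_halves hT hbr h₀
  obtain ⟨m, hm, hmap⟩ := hM.exists_map_compl hT ha hb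
  obtain ⟨s, hs, hsmap⟩ := hM.exists_map_compl hT ha h
  have hnB : ∀ z, n⁻¹ z ∈ half T b b' → z ∉ half T x₀ y₀ := fun z hz => by
    have := hoff _ (hB hz)
    rwa [RelIso.apply_inv_self] at this
  have hu : n * (m * n⁻¹ * m⁻¹) ∈ N := N.mul_mem hnN (hnorm m hm _ (N.inv_mem hnN))
  have hsB : ∀ z, z ∈ half T (s b) (s b') ↔ s⁻¹ z ∈ half T b b' := fun z => mem_half_map s
  have hsD : ∀ z, z ∈ half T (s (n b)) (s (n b')) ↔ n⁻¹ (s⁻¹ z) ∈ half T b b' := fun z => by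
    rw [mem_half_map, mem_half_map]
  refine ⟨s * (n * (m * n⁻¹ * m⁻¹)) * s⁻¹, hnorm s hs _ hu, s b, s b', s (n b), s (n b'),
    s.map_adj_iff.2 hb, s.map_adj_iff.2 (n.map_adj_iff.2 hb), ?_, ?_, ?_, ⟨s a', ?_, ?_⟩, ?_⟩
  · intro z hz
    have := hsmap _ (Set.disjoint_right.1 hAB ((hsB z).1 hz))
    rwa [RelIso.apply_inv_self] at this
  · intro z hz
    have := hsmap _ fun hc => hnB _ ((hsD z).1 hz) (hA hc)
    rwa [RelIso.apply_inv_self] at this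
  · exact Set.disjoint_left.2 fun z hz hz' => hnB _ ((hsD z).1 hz') (hB ((hsB z).1 hz))
  · rw [hsB, RelIso.inv_apply_self]
    exact Set.disjoint_left.1 hAB (right_mem_half ha)
  · rw [hsD, RelIso.inv_apply_self]
    exact fun hc => hnB _ hc (hA (right_mem_half ha))
  · intro z hz
    rw [hsB] at hz
    rw [hsD]
    simp only [RelIso.mul_apply, RelIso.inv_apply_self]
    refine hmap _ fun hc => ?_
    have h1 : m⁻¹ (s⁻¹ z) ∈ half T a a' := by
      by_contra hc'
      have := hmap _ hc'
      rw [RelIso.apply_inv_self] at this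
      exact hz this
    have h2 := hoff _ (hA hc)
    rw [RelIso.apply_inv_self] at h2
    exact h2 (hA h1)

theorem Flips.of_normalized (hT : T.IsTree) {M N : Subgroup (T ≃g T)} (hM : Flips M)
    (hbr : Branching T) (hN : N ≠ ⊥) (hnorm : ∀ m ∈ M, ∀ n ∈ N, m * n * m⁻¹ ∈ N) : Flips N := by
  intro x y h
  obtain ⟨u, hu, b, b', d, d', -, -, hB, hD, -, -, hmap⟩ :=
    hM.exists_translation hT hbr hN hnorm h
  exact ⟨u, hu, fun z hz => hD (hmap z fun hc => hz (hB hc))⟩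

/-! ### Axes of translations -/

/-- If `u` maps the complement of the half-tree `half T b b'` into the half-tree `half T d d'`,
where the two are disjoint and do not cover the tree, then `u` translates a bi-infinite path by a
positive amount. The path stays in any half-tree that contains both. -/
theorem exists_axis (hT : T.IsTree) {u : T ≃g T} {x y b b' d d' : V} (h : T.Adj x y)
    (hb : T.Adj b b') (hd : T.Adj d d') (hB : half T b b' ⊆ half T x y)
    (hD : half T d d' ⊆ half T x y) (hBD : Disjoint (half T b b') (half T d d'))
    (hw : ∃ w, w ∉ half T b b' ∧ w ∉ half T d d')
    (hmap : ∀ z, z ∉ half T b b' → u z ∈ half T d d') :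
    ∃ (c : ℤ → V) (l : ℕ), 0 < l ∧ (∀ i, T.Adj (c i) (c (i + 1))) ∧ (∀ i, c i ≠ c (i + 2)) ∧
      (∀ i, c (i + l) = u (c i)) ∧ ∀ i, c i ∈ half T x y := by
  have hbD : b ∉ half T d d' := by
    intro hc
    obtain ⟨w, hw1, hw2⟩ := hw
    obtain ⟨rfl, rfl⟩ := eq_of_adj_of_mem_half hT hd hb hc
      (Set.disjoint_left.1 hBD (right_mem_half hb))
    exact hw2 ((notMem_half_iff hT hb).1 hw1)
  have hbH : b ∈ half T x y := by
    by_contra hc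
    obtain ⟨rfl, rfl⟩ := eq_of_adj_of_mem_half hT h hb.symm (hB (right_mem_half hb)) hc
    exact Set.disjoint_left.1 hBD (hD (right_mem_half hd)) (right_mem_half hd)
  have hub : u b ∈ half T d d' := hmap b left_notMem_half
  have hinv : ∀ z, z ∉ half T d d' → u⁻¹ z ∈ half T b b' := by
    intro z hz
    by_contra hc
    have := hmap _ hc
    rw [RelIso.apply_inv_self] at this
    exact hz this
  have horb : ∀ q : ℤ, (u ^ q) b ∈ half T x y := by
    have hpos : ∀ n : ℕ, (u ^ n) b ∉ half T b b' := by
      intro n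
      induction n with
      | zero => exact left_notMem_half
      | succ n ih =>
        rw [pow_succ', RelIso.mul_apply]
        exact Set.disjoint_right.1 hBD (hmap _ ih)
    have hneg : ∀ n : ℕ, (u⁻¹ ^ n) b ∉ half T d d' := by
      intro n
      induction n with
      | zero => exact hbD
      | succ n ih =>
        rw [pow_succ', RelIso.mul_apply]
        exact Set.disjoint_left.1 hBD (hinv _ ih)
    intro q
    obtain ⟨n, rfl | rfl⟩ := q.eq_nat_or_neg
    · cases n with
      | zero => exact hbH
      | succ n =>
        rw [zpow_natCast, pow_succ', RelIso.mul_apply]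
        exact hD (hmap _ (hpos n))
    · cases n with
      | zero => exact hbH
      | succ n =>
        rw [zpow_neg, zpow_natCast, ← inv_pow, pow_succ', RelIso.mul_apply]
        exact hB (hinv _ (hneg n))
  obtain ⟨p, hp0, hpl, hpadj, hpd⟩ := exists_geodesic hT b (u b)
  obtain ⟨l, hl⟩ : ∃ l, T.dist b (u b) = l := ⟨_, rfl⟩
  rw [hl] at hpl hpadj hpd
  have hl0 : 0 < l := by
    rw [← hl]
    refine hT.connected.pos_dist_of_ne fun e => hbD ?_
    rw [e]; exact hub
  -- the geodesic leaves `b` away from `b'` and arrives at `u b` through `u b'`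
  have hp1 : p 1 ≠ b' := by
    intro e
    have := half_convex hT hb.symm (w := p 1) ((notMem_half_iff hT hb).1 left_notMem_half)
      ((notMem_half_iff hT hb).1 (Set.disjoint_right.1 hBD hub)) (by
        rw [(hpd 1 hl0).1, (hpd 1 hl0).2, hl]; omega)
    rw [e] at this
    exact left_notMem_half this
  have hplast : p (l - 1) = u b' := by
    have hmem : b ∈ half T (u b) (u b') := by
      rw [mem_half_map]
      exact hinv _ hbD
    have hadj : T.Adj (u b) (p (l - 1)) := by
      have := hpadj (l - 1) (by omega)
      rw [Nat.sub_add_cancel hl0, hpl] at this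
      exact this.symm
    refine closer_unique hT (u := b) hadj (u.map_adj_iff.2 hb) ?_
      (dist_of_mem_half hT (u.map_adj_iff.2 hb) hmem)
    rw [hl, (hpd _ (by omega)).1]; omega
  have hlz : (l : ℤ) ≠ 0 := by omega
  let c : ℤ → V := fun i => (u ^ (i / l)) (p (i % l).toNat)
  have hcq : ∀ i q : ℤ, c (i + l * q) = (u ^ q) (c i) := by
    intro i q
    simp only [c]
    rw [Int.add_mul_ediv_left _ _ hlz, Int.add_mul_emod_self_left, add_comm, zpow_add,
      RelIso.mul_apply]
  have hcl : ∀ i, c (i + l) = u (c i) := by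
    intro i
    have := hcq i 1
    rwa [mul_one, zpow_one] at this
  have hcp : ∀ i : ℕ, i < l → c i = p i := by
    intro i hi
    have h1 : (i : ℤ) / l = 0 := Int.ediv_eq_zero_of_lt (by omega) (by omega)
    have h2 : (i : ℤ) % l = i := Int.emod_eq_of_lt (by omega) (by omega)
    simp [c, h1, h2]
  have hcp' : ∀ i : ℕ, i ≤ l → c i = p i := by
    intro i hi
    rcases hi.lt_or_eq with hi | rfl
    · exact hcp i hi
    · have := hcl 0
      rw [zero_add] at this
      rw [this, hpl, ← hp0]
      exact congrArg u (hcp 0 hl0)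
  have hred : ∀ i : ℤ, ∃ (r : ℕ) (q : ℤ), r < l ∧ i = r + l * q := fun i =>
    ⟨(i % l).toNat, i / l, by have := Int.emod_lt_of_pos i (b := l) (by omega); omega, by
      rw [Int.toNat_of_nonneg (Int.emod_nonneg _ hlz), Int.emod_add_mul_ediv]⟩
  refine ⟨c, l, hl0, ?_, ?_, hcl, ?_⟩
  · intro i
    obtain ⟨r, q, hr, rfl⟩ := hred i
    rw [show (r : ℤ) + l * q + 1 = ((r + 1 : ℕ) : ℤ) + l * q by push_cast; ring, hcq, hcq,
      hcp r hr, hcp' (r + 1) hr]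
    exact (u ^ q).map_adj_iff.2 (hpadj r hr)
  · intro i
    obtain ⟨r, q, hr, rfl⟩ := hred i
    rw [show (r : ℤ) + l * q + 2 = ((r + 2 : ℕ) : ℤ) + l * q by push_cast; ring, hcq, hcq,
      hcp r hr]
    refine (u ^ q).injective.ne fun e => ?_
    by_cases hr2 : r + 2 ≤ l
    · rw [hcp' _ hr2] at e
      have h1 := (hpd r hr.le).1
      have h2 := (hpd (r + 2) hr2).1
      rw [e] at h1
      omega
    · have hrl : r = l - 1 := by omega
      have e2 : ((r + 2 : ℕ) : ℤ) = ((1 : ℕ) : ℤ) + l := by omega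
      rw [e2, hcl, hcp' 1 hl0, hrl, hplast] at e
      exact hp1 (u.injective e).symm
  · intro i
    obtain ⟨r, q, hr, rfl⟩ := hred i
    rw [hcq, hcp r hr]
    refine half_convex hT h (horb q) (horb (q + 1)) ?_
    rw [zpow_add_one, RelIso.mul_apply, dist_map, dist_map, dist_map, (hpd r hr.le).1,
      (hpd r hr.le).2, hl]
    omega

/-! ### Consequences of Property `P_k` -/

/-- Surjectivity in Property `P_k`: elements chosen over the vertices of `C` can be glued along the
fibres. -/
theorem PropertyP.exists_glue {k : ℕ} {G : Subgroup (T ≃g T)} (hP : PropertyP k G) {C : Set V}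
    (hC : IsReducedPath T C) (τ : V → (T ≃g T))
    (hτ : ∀ x ∈ C, τ x ∈ fixator G (nbhd T C (k - 1))) :
    ∃ t ∈ fixator G (nbhd T C (k - 1)), ∀ x ∈ C, ∀ z ∈ fibre T C x, t z = τ x z := by
  obtain ⟨t, ht⟩ := (hP C hC).2
    fun x => (restrictHom G C (k - 1) x).rangeRestrict ⟨τ x, hτ x x.2⟩
  refine ⟨t, t.2, fun x hx z hz => ?_⟩
  have h1 := congrArg Subtype.val (congrFun ht ⟨x, hx⟩)
  have h2 := DFunLike.congr_fun h1 (⟨z, hz⟩ : fibre T C x)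
  exact congrArg Subtype.val h2

theorem exists_mem_fibre {C : Set V} (hC : C.Nonempty) (z : V) : ∃ x ∈ C, z ∈ fibre T C x := by
  obtain ⟨x, hx, hmin⟩ := WellFounded.has_min (measure fun x => T.dist x z).wf C hC
  exact ⟨x, hx, fun y hy => not_lt.1 (hmin y hy)⟩

/-- If `h ∈ G` translates the path `c`, then every element of the fixator of a neighbourhood of `c`
is a commutator of `h` with an element `t` of this fixator. On the fibres over the `q`-th
fundamental domain, `t` is `(g⁻¹ h) ^ q h ^ (-q)`. -/
theorem PropertyP.exists_commutator (hT : T.IsTree) {k : ℕ} {G : Subgroup (T ≃g T)}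
    (hP : PropertyP k G) {h : T ≃g T} (hG : h ∈ G) {c : ℤ → V} {l : ℕ} (hl : 0 < l)
    (hadj : ∀ i, T.Adj (c i) (c (i + 1))) (hback : ∀ i, c i ≠ c (i + 2))
    (htrans : ∀ i, c (i + l) = h (c i)) {g : T ≃g T}
    (hg : g ∈ fixator G (nbhd T (Set.range c) (k - 1))) :
    ∃ t ∈ fixator G (nbhd T (Set.range c) (k - 1)), g = h * t * h⁻¹ * t⁻¹ := by
  have hC : IsReducedPath T (Set.range c) :=
    ⟨Set.univ, c, Set.univ_nonempty, Set.ordConnected_univ, fun i _ _ => hadj i,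
      fun i _ _ => hback i, Set.image_univ.symm⟩
  have hlz : (l : ℤ) ≠ 0 := by omega
  have htrans' : ∀ i, c (i - l) = h⁻¹ (c i) := fun i => by
    have := htrans (i - l)
    rw [sub_add_cancel] at this
    rw [this, RelIso.inv_apply_self]
  have hinj : Function.Injective c := by
    have key : ∀ i : ℤ, ∀ n : ℕ, c i = c (i + n) → n = 0 := by
      intro i n e
      have := dist_of_noBacktrack hT (fun j => c (i + j)) n
        (fun j _ => by have := hadj (i + j); rwa [add_assoc] at this)
        (fun j _ => by have := hback (i + j); rwa [add_assoc] at this) n le_rfl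
      simp only [Nat.cast_zero, add_zero, ← e, T.dist_self] at this
      exact this.symm
    intro i j e
    rcases le_total i j with hij | hij
    · have := key i (j - i).toNat (by rw [e]; congr 1; omega)
      omega
    · have := key j (i - j).toNat (by rw [← e]; congr 1; omega)
      omega
  have hnb : ∀ z ∈ nbhd T (Set.range c) (k - 1), h z ∈ nbhd T (Set.range c) (k - 1) := by
    rintro z ⟨_, ⟨i, rfl⟩, hz⟩
    exact ⟨_, ⟨i + l, rfl⟩, by rw [htrans, dist_map]; exact hz⟩
  have hnb' : ∀ z ∈ nbhd T (Set.range c) (k - 1), h⁻¹ z ∈ nbhd T (Set.range c) (k - 1) := by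
    rintro z ⟨_, ⟨i, rfl⟩, hz⟩
    exact ⟨_, ⟨i - l, rfl⟩, by rw [htrans', dist_map]; exact hz⟩
  have hnorm : ∀ f, h * f * h⁻¹ ∈ fixator G (nbhd T (Set.range c) (k - 1)) ↔
      f ∈ fixator G (nbhd T (Set.range c) (k - 1)) := by
    intro f
    constructor
    · rintro ⟨h1, h2⟩
      refine ⟨by simpa [mul_assoc] using G.mul_mem (G.mul_mem (G.inv_mem hG) h1) hG,
        fun z hz => ?_⟩
      have := h2 _ (hnb z hz)
      simp only [RelIso.mul_apply, RelIso.inv_apply_self] at this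
      exact h.injective this
    · rintro ⟨h1, h2⟩
      refine ⟨G.mul_mem (G.mul_mem hG h1) (G.inv_mem hG), fun z hz => ?_⟩
      simp only [RelIso.mul_apply]
      rw [h2 _ (hnb' z hz), RelIso.apply_inv_self]
  let σ : ℤ → (T ≃g T) := fun q => (g⁻¹ * h) ^ q * h ^ (-q)
  have hσ : ∀ q, σ (q + 1) = g⁻¹ * (h * σ q * h⁻¹) := by
    intro q
    simp only [σ]
    rw [add_comm q 1, zpow_add, zpow_one, neg_add_rev, zpow_add, zpow_neg_one]
    simp only [mul_assoc]
  have hσF : ∀ q, σ q ∈ fixator G (nbhd T (Set.range c) (k - 1)) := by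
    have hstep : ∀ q, σ (q + 1) ∈ fixator G (nbhd T (Set.range c) (k - 1)) ↔
        σ q ∈ fixator G (nbhd T (Set.range c) (k - 1)) := fun q => by
      rw [hσ, Subgroup.mul_mem_cancel_left _ (inv_mem hg), hnorm]
    intro q
    induction q with
    | zero => simp [σ]
    | succ i ih => exact (hstep _).2 ih
    | pred i ih => exact (hstep _).1 (by rwa [sub_add_cancel])
  obtain ⟨t, ht, hglue⟩ := hP.exists_glue hC (fun x => σ (Function.invFun c x / l))
    fun x _ => hσF _
  have hglue' : ∀ i, ∀ z ∈ fibre T (Set.range c) (c i), t z = σ (i / l) z := fun i z hz => by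
    have := hglue (c i) ⟨i, rfl⟩ z hz
    rwa [Function.leftInverse_invFun hinj i] at this
  refine ⟨t, ht, ?_⟩
  rw [eq_mul_inv_iff_mul_eq]
  refine RelIso.ext fun z => ?_
  obtain ⟨_, ⟨i, rfl⟩, hz⟩ := exists_mem_fibre (T := T) (Set.range_nonempty c) z
  have hz' : h⁻¹ z ∈ fibre T (Set.range c) (c (i - l)) := by
    rintro _ ⟨j, rfl⟩
    have h1 := hz _ ⟨j + l, rfl⟩
    have h2 := dist_map h⁻¹ (c (j + l)) z
    rw [← htrans', add_sub_cancel_right] at h2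
    rw [htrans', dist_map, h2]
    exact h1
  have hq : (i - l) / (l : ℤ) = i / l - 1 := by
    have := Int.add_mul_ediv_left i (-1) hlz
    rw [mul_neg, mul_one] at this
    exact this
  simp only [RelIso.mul_apply]
  have hrec := hσ (i / l - 1)
  rw [sub_add_cancel] at hrec
  rw [hglue' i z hz, hglue' _ _ hz', hq, hrec]
  simp only [RelIso.mul_apply, RelIso.apply_inv_self]

/-- The neighbourhood of a set inside a half-tree lies in the half-tree and the neighbourhood of its
boundary edge. -/
theorem nbhd_subset_of_subset_half (hT : T.IsTree) {x y : V} (h : T.Adj x y) {C : Set V}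
    (hC : C ⊆ half T x y) (n : ℕ) : nbhd T C n ⊆ half T x y ∪ nbhd T {x, y} n := by
  rintro z ⟨c, hc, hz⟩
  by_cases hzh : z ∈ half T x y
  · exact Or.inl hzh
  · refine Or.inr ⟨x, by simp, ?_⟩
    have := dist_of_mem_half_of_notMem hT h (hC hc) hzh
    omega

/-- Under Property `P_k`, the fixator of an edge neighbourhood is generated by its elements that fix
one of the two half-trees. -/
theorem PropertyP.fixator_edge_le {k : ℕ} {G N : Subgroup (T ≃g T)}
    (hP : PropertyP k G)
    (hN : ∀ x y, T.Adj x y → ∀ a ∈ fixator G (nbhd T {x, y} (k - 1)),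
      (∀ z ∈ half T x y, a z = z) → a ∈ N) {x y : V} (h : T.Adj x y) :
    fixator G (nbhd T {x, y} (k - 1)) ≤ N := by
  classical
  intro g hg
  have hC : IsReducedPath T ({x, y} : Set V) := by
    refine ⟨Set.Icc 0 1, fun i => if i = 0 then x else y, ⟨0, by simp⟩, Set.ordConnected_Icc,
      ?_, ?_, ?_⟩
    · rintro i ⟨h1, h2⟩ ⟨h3, h4⟩
      obtain rfl : i = 0 := by omega
      simpa using h
    · rintro i ⟨h1, h2⟩ ⟨h3, h4⟩
      omega
    · ext v
      constructor
      · rintro (rfl | rfl)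
        · exact ⟨0, by simp⟩
        · exact ⟨1, by simp⟩
      · rintro ⟨i, -, rfl⟩
        dsimp only
        split_ifs <;> simp
  obtain ⟨t, ht, hglue⟩ := hP.exists_glue hC (fun v => if v = x then g else 1) (by
    intro v _
    split_ifs
    · exact hg
    · exact one_mem _)
  have hfib : ∀ {a b z : V}, z ∈ half T a b → z ∈ fibre T {a, b} b := by
    rintro a b z hz v (rfl | rfl)
    · rw [T.dist_comm, T.dist_comm (u := v)]; exact le_of_lt hz
    · exact le_rfl
  have htN : t ∈ N := hN x y h t ht fun z hz => by
    have := hglue y (by simp) z (hfib hz)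
    simpa [h.ne'] using this
  have htg : t⁻¹ * g ∈ N := by
    refine hN y x h.symm _ ?_ fun z hz => ?_
    · rw [Set.pair_comm]
      exact mul_mem (inv_mem ht) hg
    · have := hglue x (by simp) z (by rw [Set.pair_comm]; exact hfib hz)
      simp only [if_true] at this
      rw [RelIso.mul_apply, ← this, RelIso.inv_apply_self]
  simpa using mul_mem htN htg

/-! ### The subgroup generated by the fixators of edges -/

theorem fixator_le_plus {k : ℕ} {G : Subgroup (T ≃g T)} {x y : V} (h : T.Adj x y) :
    fixator G (nbhd T {x, y} (k - 1)) ≤ plus k G :=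
  le_iSup_of_le x (le_iSup_of_le y (le_iSup_of_le h le_rfl))

theorem plus_le {k : ℕ} {G : Subgroup (T ≃g T)} : plus k G ≤ G :=
  iSup_le fun _ => iSup_le fun _ => iSup_le fun _ _ hg => hg.1

theorem conj_mem_plus {k : ℕ} {G : Subgroup (T ≃g T)} {m : T ≃g T} (hm : m ∈ G) {n : T ≃g T}
    (hn : n ∈ plus k G) : m * n * m⁻¹ ∈ plus k G := by
  suffices plus k G ≤ (plus k G).comap (MulAut.conj m).toMonoidHom from this hn
  refine iSup_le fun x => iSup_le fun y => iSup_le fun h g hg => ?_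
  refine fixator_le_plus (m.map_adj_iff.2 h)
    ⟨G.mul_mem (G.mul_mem hm hg.1) (G.inv_mem hm), ?_⟩
  rintro z ⟨v, hv, hz⟩
  have key : m⁻¹ z ∈ nbhd T {x, y} (k - 1) := by
    refine ⟨m⁻¹ v, ?_, by rwa [dist_map]⟩
    rcases hv with rfl | rfl
    · rw [RelIso.inv_apply_self]; simp
    · rw [RelIso.inv_apply_self]; simp
  change m (g (m⁻¹ z)) = z
  rw [hg.2 _ key, RelIso.apply_inv_self]

theorem branching_of_plus_ne_bot (hT : T.IsTree) {k : ℕ} {G : Subgroup (T ≃g T)}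
    (hne : plus k G ≠ ⊥) : Branching T := by
  by_contra hc
  refine hne (le_bot_iff.1 (iSup_le fun x => iSup_le fun y => iSup_le fun h g hg => ?_))
  by_contra hg1
  exact hc (branching_of_fix_edge hT hg1 h (hg.2 x ⟨x, by simp⟩) (hg.2 y ⟨y, by simp⟩))

/-- A nontrivial subgroup of `plus k G` normalized by `plus k G` is all of it. It contains a
translation along an axis in each half-tree; the elements that fix that half-tree and a
neighbourhood of its boundary edge fix a neighbourhood of the axis, so they are commutators with the
translation. -/
theorem plus_le_of_normalized (hT : T.IsTree) {k : ℕ} {G N : Subgroup (T ≃g T)}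
    (hdense : GeometricallyDense G) (hP : PropertyP k G) (hNp : N ≤ plus k G) (hN : N ≠ ⊥)
    (hnorm : ∀ m ∈ plus k G, ∀ n ∈ N, m * n * m⁻¹ ∈ N) : plus k G ≤ N := by
  have hne : plus k G ≠ ⊥ := fun e => hN (le_bot_iff.1 (e ▸ hNp))
  have hbr := branching_of_plus_ne_bot hT hne
  have hflip : Flips (plus k G) :=
    (hdense.flips hT).of_normalized hT hbr hne fun m hm n hn => conj_mem_plus hm hn
  refine iSup_le fun x => iSup_le fun y => iSup_le fun h => hP.fixator_edge_le ?_ h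
  intro x y h a ha hfix
  obtain ⟨u, hu, b, b', d, d', hb, hd, hB, hD, hBD, hw, hmap⟩ :=
    hflip.exists_translation hT hbr hN hnorm h
  obtain ⟨c, l, hl, hadj, hback, htrans, hch⟩ := exists_axis hT h hb hd hB hD hBD hw hmap
  have ha' : a ∈ fixator G (nbhd T (Set.range c) (k - 1)) := by
    refine ⟨ha.1, fun z hz => ?_⟩
    rcases nbhd_subset_of_subset_half hT h (Set.range_subset_iff.2 hch) _ hz with hz | hz
    · exact hfix z hz
    · exact ha.2 z hz
  obtain ⟨t, ht, rfl⟩ := hP.exists_commutator hT (plus_le (hNp hu)) hl hadj hback htrans ha'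
  have htp : t ∈ plus k G := by
    refine fixator_le_plus (hadj 0) ⟨ht.1, fun z hz => ht.2 z ?_⟩
    obtain ⟨v, hv, hz⟩ := hz
    refine ⟨v, ?_, hz⟩
    rcases hv with rfl | rfl
    · exact ⟨_, rfl⟩
    · exact ⟨_, rfl⟩
  have := N.mul_mem hu (hnorm t htp _ (N.inv_mem hu))
  simpa only [mul_assoc] using this

end TreeAut

theorem theorem3p1 {V : Type*} [Countable V] (T : SimpleGraph V) (hT : T.IsTree)
    (hline : IsEmpty (T ≃g SimpleGraph.hasse ℤ))
    (k : ℕ) (hk : 1 ≤ k) (G : Subgroup (T ≃g T))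
    (hdense : TreeAut.GeometricallyDense G) (hP : TreeAut.PropertyP k G) :
    TreeAut.plus k G = ⊥ ∨ IsSimpleGroup (TreeAut.plus k G) := by
  by_cases hne : TreeAut.plus k G = ⊥
  · exact Or.inl hne
  refine Or.inr { toNontrivial := (Subgroup.nontrivial_iff_ne_bot _).2 hne
                  eq_bot_or_eq_top_of_normal := fun H hH => ?_ }
  by_cases hbot : H = ⊥
  · exact Or.inl hbot
  refine Or.inr (eq_top_iff.2 fun g _ => ?_)
  have hle := TreeAut.plus_le_of_normalized hT (N := H.map (TreeAut.plus k G).subtype) hdense hP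
    (Subgroup.map_subtype_le H)
    (fun e => hbot ((Subgroup.map_eq_bot_iff_of_injective H (Subgroup.subtype_injective _)).1 e)) (by
      rintro m hm _ ⟨n, hn, rfl⟩
      exact ⟨⟨m, hm⟩ * n * ⟨m, hm⟩⁻¹, hH.conj_mem n hn ⟨m, hm⟩, rfl⟩)
  obtain ⟨g', hg', e⟩ := hle g.2
  rwa [← Subtype.ext e]
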